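/- Let $P$ be a simple polygon in the plane with edge set $E$, and let $\delta\colon E\to\mathbb{R}^+_0$ be additive weights. The wavefront $\mathcal{W}_{P,\delta}(t)$ is a finite set of simple polygons that evolves with time $t\ge 0$ as follows. $\mathcal{W}_{P,\delta}(0)$ is $P$. Every wavefront edge is a fragment of an edge $e$ of $P$, oriented as $e$, and at time $t$ it lies on $\overline{e}+\max(0,t-\delta(e))\cdot n_e$, where $\overline{e}$ is the supporting line of $e$ and $n_e$ its inward unit normal. Incidences are preserved between finitely many event times, so that a wavefront vertex is the common point of the two moved supporting lines of its incident edges (if these lines coincide, with equal orientation, the vertex moves perpendicularly to them). At an event time, edges that have shrunk to length zero are removed; portions common to two oppositely oriented parallel edges that have moved into each other are removed; all other portions of edges stay; and polygons that touch themselves are split at the points of contact, so that all wavefront polygons are simple again. The process ends when the wavefront is empty. We assume that $(P,\delta)$ admits such a propagation process. The additively-weighted straight skeleton $\mathcal{S}(P,\delta)$ is the union of the traces of all wavefront vertices over the propagation period and of all portions common to two parallel wavefront edges that move into each other. For $t\ge 0$, let $\mathcal{S}_{P,\delta}(t)$ be the portion of $\mathcal{S}(P,\delta)$ traced until time $t$,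 and regard $\mathcal{W}_{P,\delta}(t)$ as the union of its edges. Let $t\ge 0$. If two points $p,q\in\mathcal{S}_{P,\delta}(t)$ are path-connected in $\mathcal{S}_{P,\delta}(t)\cup\mathcal{W}_{P,\delta}(t)$, then they are path-connected in $\mathcal{S}(P,\delta)$. -/

import Mathlib

namespace StraightSkeleton

/-!
The plane is identified with `ℂ`.  A family of closed polygons is given by a permutation `next`
of its vertices; its cycles are the polygons, and the edge of a vertex `v` is the segment from
`v` to `next v`.
-/

/-- The closed edge from the vertex `v` to its successor. -/
def edgeSeg {V : Type} (next : Equiv.Perm V) (x : V → ℂ) (v : V) : Set ℂ :=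
  segment ℝ (x v) (x (next v))

/-- Every cycle of `next` is a simple polygon: edges have positive length, and two different
edges of one polygon share no point except the common vertex of two consecutive edges. -/
def IsSimple {V : Type} (next : Equiv.Perm V) (x : V → ℂ) : Prop :=
  (∀ v, x v ≠ x (next v)) ∧
  ∀ v w, next.SameCycle v w → v ≠ w → ∀ z ∈ edgeSeg next x v ∩ edgeSeg next x w,
    (w = next v ∧ z = x w) ∨ (v = next w ∧ z = x v)

/-- A simple polygon whose vertices are listed counterclockwise (its signed area is positive),
so that the interior lies to the left of every edge.  Edge `i` joins the vertices `i` and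
`i + 1` (cyclically). -/
structure SimplePolygon (n : ℕ) extends Polygon ℂ n where
  three_le : 3 ≤ n
  simple : IsSimple (finRotate n) vertices
  ccw : 0 < ∑ i, ((vertices i).re * (vertices (finRotate n i)).im
    - (vertices i).im * (vertices (finRotate n i)).re)

namespace SimplePolygon

variable {n : ℕ} (P : SimplePolygon n)

/-- Unit direction of the polygon edge `e`. -/
noncomputable def dir (e : Fin n) : ℂ :=
  (‖P.vertices (finRotate n e) - P.vertices e‖⁻¹ : ℝ) •
    (P.vertices (finRotate n e) - P.vertices e)

/-- Inward unit normal of the polygon edge `e`: the direction turned left by a right angle. -/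
noncomputable def normal (e : Fin n) : ℂ := Complex.I * P.dir e

end SimplePolygon

/-- Distance that an edge with additive weight `d` has moved by time `t`. -/
noncomputable def offset (d : NNReal) (t : ℝ) : ℝ := max 0 (t - d)

/-- The supporting line of the polygon edge `e`, moved to its position at time `t`:
`ē + max(0, t - δ(e)) · n_e`. -/
noncomputable def movedLine {n : ℕ} (P : SimplePolygon n) (δ : Fin n → NNReal) (e : Fin n)
    (t : ℝ) : Set ℂ :=
  {z | ∃ r : ℝ, z = P.vertices e + r • P.dir e + offset (δ e) t • P.normal e}

/-- A moving family of polygons with a fixed combinatorial structure.  The vertices are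
`Fin m` (the family is empty if `m = 0`), the polygons are the cycles of `next`, the edge from
`v` to `next v` is a fragment of the polygon edge `label v`, and `pos v t` is the location of
the vertex `v` at time `t`. -/
structure KineticWavefront (n : ℕ) where
  m : ℕ
  next : Equiv.Perm (Fin m)
  label : Fin m → Fin n
  pos : Fin m → ℝ → ℂ

namespace KineticWavefront

variable {n : ℕ} (K : KineticWavefront n)

/-- The wavefront edge from `v` to its successor at time `t`. -/
def edge (v : Fin K.m) (t : ℝ) : Set ℂ := edgeSeg K.next (fun u => K.pos u t) v

/-- The portion common to the wavefront edges of `v` and `w` at time `t`, if these two edges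
are parallel with opposite orientation (so that they move into each other). -/
def common (P : SimplePolygon n) (v w : Fin K.m) (t : ℝ) : Set ℂ :=
  {z | P.dir (K.label w) = - P.dir (K.label v) ∧ z ∈ K.edge v t ∧ z ∈ K.edge w t}

/-- Propagation without a combinatorial change from time `a` to time `b`: each wavefront edge
is a fragment of the moved supporting line of its polygon edge, incidences are preserved, and
up to (not including) time `b` every wavefront edge has positive length, is oriented as its
polygon edge, and every wavefront polygon is simple. (The bounded regions of different
wavefront polygons are disjoint and shrink, so different wavefront polygons do not interact.)

The two supporting lines determine a vertex, unless they are the same line for two edges with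
the same orientation; such a vertex (interior angle `180°`) moves perpendicularly to them. -/
structure Propagates (P : SimplePolygon n) (δ : Fin n → NNReal) (a b : ℝ) : Prop where
  continuousOn : ∀ v, ContinuousOn (K.pos v) (Set.Icc a b)
  on_line : ∀ v, ∀ t ∈ Set.Icc a b,
    K.pos v t ∈ movedLine P δ (K.label v) t ∧ K.pos (K.next v) t ∈ movedLine P δ (K.label v) t
  straight_angle : ∀ v, P.dir (K.label (K.next v)) = P.dir (K.label v) → ∀ t ∈ Set.Icc a b,
    K.pos (K.next v) t = K.pos (K.next v) a +
      (offset (δ (K.label v)) t - offset (δ (K.label v)) a) • P.normal (K.label v)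
  oriented : ∀ v, ∀ t ∈ Set.Ico a b, ∃ r : ℝ, 0 < r ∧
    K.pos (K.next v) t - K.pos v t = r • P.dir (K.label v)
  simple : ∀ t ∈ Set.Ico a b, IsSimple K.next (fun v => K.pos v t)

/-- The wavefront `K'` results from the wavefront `K` by the edge and split events (elementary
or not) at time `t`.  Each edge of `K'` is a portion of an edge of `K`, its parent.

* Edges of `K` that have shrunk to zero length are dropped (an edge of a propagating wavefront
  has positive length initially, so it cannot be the child of such an edge).
* Portions common to two edges that have moved into each other are dropped.
* Everything else stays in the wavefront, without overlaps.
* Polygons are split but never joined, and an edge is split only where its two portions become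
  nonadjacent.

Together with the simplicity of the polygons of `K'`, this says that a polygon which touches
itself is split at the points of contact. -/
def Event (P : SimplePolygon n) (K K' : KineticWavefront n) (t : ℝ) : Prop :=
  ∃ parent : Fin K'.m → Fin K.m,
    (∀ u, K'.label u = K.label (parent u)) ∧
    (∀ u, K'.edge u t ⊆ K.edge (parent u) t) ∧
    (∀ v, K.pos v t ≠ K.pos (K.next v) t → ∀ z ∈ K.edge v t,
      (∃ u, parent u = v ∧ z ∈ K'.edge u t) ∨ (∃ w, z ∈ K.common P v w t)) ∧
    (∀ u u', u ≠ u' → parent u = parent u' → (K'.edge u t ∩ K'.edge u' t).Subsingleton) ∧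
    (∀ u w, (K'.edge u t ∩ K.common P (parent u) w t).Subsingleton) ∧
    (∀ u u', K'.next.SameCycle u u' → K.next.SameCycle (parent u) (parent u')) ∧
    (∀ u, parent (K'.next u) ≠ parent u)

end KineticWavefront

/-- The wavefront propagation process of the simple polygon `P` with additive weights `δ`:
it starts at time `0` with `P` itself, propagates without combinatorial change between the
finitely many times `time 0 < ⋯ < time N`, is updated by the events at the times
`time 1, …, time N`, and ends at `time N` with the empty wavefront.  Speed changes are part of
`Propagates`, as they do not alter the combinatorial structure. -/
structure WavefrontPropagation {n : ℕ} (P : SimplePolygon n) (δ : Fin n → NNReal) where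
  N : ℕ
  time : ℕ → ℝ
  wave : ℕ → KineticWavefront n
  time_zero : time 0 = 0
  time_lt : ∀ i < N, time i < time (i + 1)
  start : ∃ φ : Fin n ≃ Fin (wave 0).m, ∀ i, (wave 0).next (φ i) = φ (finRotate n i) ∧
    (wave 0).label (φ i) = i ∧ (wave 0).pos (φ i) 0 = P.vertices i
  propagates : ∀ i < N, (wave i).Propagates P δ (time i) (time (i + 1))
  event : ∀ i < N, KineticWavefront.Event P (wave i) (wave (i + 1)) (time (i + 1))
  finish : (wave N).m = 0

namespace WavefrontPropagation

variable {n : ℕ} {P : SimplePolygon n} {δ : Fin n → NNReal} (W : WavefrontPropagation P δ)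

/-- The wavefront `𝓦_{P,δ}(t)` as a point set: the union of all wavefront edges at time `t`
(after the events at time `t`; it is empty from the end of the process on). -/
def wavefront (t : ℝ) : Set ℂ :=
  {z | ∃ i < W.N, W.time i ≤ t ∧ t < W.time (i + 1) ∧ ∃ v, z ∈ (W.wave i).edge v t}

/-- The portion `𝓢_{P,δ}(t)` of the straight skeleton traced until time `t`: the traces of the
wavefront vertices up to time `t`, and the portions common to two wavefront edges that have
moved into each other by time `t`. -/
def skeletonUntil (t : ℝ) : Set ℂ :=
  {z | ∃ i < W.N, ∃ v, ∃ s ∈ Set.Icc (W.time i) (W.time (i + 1)),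
      s ≤ t ∧ z = (W.wave i).pos v s} ∪
  {z | ∃ i < W.N, W.time (i + 1) ≤ t ∧
      ∃ v w, z ∈ (W.wave i).common P v w (W.time (i + 1))}

/-- The additively-weighted straight skeleton `𝓢(P, δ)`. -/
def skeleton : Set ℂ := ⋃ t : ℝ, W.skeletonUntil t

end WavefrontPropagation

end StraightSkeleton

/-!
The skeleton is path-connected, because its traces link any two wavefront vertices.

Going backwards in time from the empty wavefront, the endpoints of every wavefront edge are joined
in the skeleton. At an event, the pieces into which an edge decomposes are edges of the new
wavefront, whose endpoints are joined already, and portions common to two edges that have moved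
into each other, which belong to the skeleton; neighbouring pieces share only endpoints. So the
vertices of one wavefront polygon are joined in the skeleton; in particular, those of the input
polygon are.

Going forwards in time, every polygon arising at an event is closed, so it has a vertex at which
its direction changes. The two edges incident to it are portions of two edges of one old polygon
with different directions. If these directions are opposite, the vertex lies on a portion common to
two edges that have moved into each other, and such a portion contains an old vertex. Otherwise the
vertex is an old vertex itself, since a transversal crossing of two edges would have existed before
the event.
-/

namespace StraightSkeleton

open Set Filter Topology

section Covers

variable {X ι : Type*} [TopologicalSpace X] {s : Set X} {A : ι → Set X}

theorem exists_nontrivial_mem_of_cover [T1Space X] (hs : IsPreconnected s) (hs' : s.Nontrivial)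
    (hA : LocallyFinite A) (hAc : ∀ j, IsClosed (A j)) (hcov : s ⊆ ⋃ j, A j) {x : X}
    (hx : x ∈ s) : ∃ j, (A j).Nontrivial ∧ x ∈ A j := by
  have hacc := accPt_iff_frequently.1 (hs.preperfect_of_nontrivial hs' x hx)
  obtain ⟨y, ⟨hyx, hy⟩, hsub⟩ := (hacc.and_eventually (hA.eventually_subset hAc x)).exists
  obtain ⟨j, hj⟩ := mem_iUnion.1 (hcov hy)
  exact ⟨j, ⟨y, hj, x, hsub hj, hyx⟩, hsub hj⟩

theorem rel_of_cover (hs : IsPreconnected s) (hA : LocallyFinite A) (hAc : ∀ j, IsClosed (A j))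
    (hcov : s ⊆ ⋃ j, A j) {r : ι → ι → Prop} (trans : ∀ {i j k}, r i j → r j k → r i k)
    (hmeet : ∀ x ∈ s, ∀ j k, x ∈ A j → x ∈ A k → r j k) {x y : X} (hx : x ∈ s) (hy : y ∈ s)
    {j k : ι} (hj : x ∈ A j) (hk : y ∈ A k) : r j k := by
  refine hs.induction₂' (fun x y => ∀ j k, x ∈ A j → y ∈ A k → r j k) (fun x hx => ?_)
    (fun x y z _ hy _ hxy hyz j k hj hk => ?_) hx hy j k hj hk
  · filter_upwards [nhdsWithin_le_nhds (hA.eventually_subset hAc x)] with y hsub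
    exact ⟨fun j k hj hk => hmeet x hx j k hj (hsub hk),
      fun j k hj hk => hmeet x hx j k (hsub hj) hk⟩
  · obtain ⟨l, hl⟩ := mem_iUnion.1 (hcov hy)
    exact trans (hxy j l hj hl) (hyz l k hl hk)

/-- The sets `T j ⊆ A j` single out points at which the piece `A j` may touch other pieces. -/
theorem rel_of_cover_of_contacts [T1Space X] (hs : IsPreconnected s) (hs' : s.Nontrivial)
    (hA : LocallyFinite A) (hAc : ∀ j, IsClosed (A j)) (hcov : s ⊆ ⋃ j, A j) {T : ι → Set X}
    (hTne : ∀ j, (A j).Nontrivial → (T j).Nonempty) {r : X → X → Prop}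
    (trans : ∀ {x y z}, r x y → r y z → r x z) (hT : ∀ j, ∀ x ∈ T j, ∀ y ∈ T j, r x y)
    (hmeet : ∀ j k, j ≠ k → (A j).Nontrivial → (A k).Nontrivial → A j ∩ A k ⊆ T j) {x y : X}
    (hx : x ∈ s) (hy : y ∈ s) (hxT : ∀ j, x ∈ A j → x ∈ T j) (hyT : ∀ j, y ∈ A j → y ∈ T j) :
    r x y := by
  have hcov' : ∀ z ∈ s, ∃ j, (A j).Nontrivial ∧ z ∈ A j := fun z hz =>
    exists_nontrivial_mem_of_cover hs hs' hA hAc hcov hz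
  obtain ⟨j, hj, hxj⟩ := hcov' x hx
  obtain ⟨k, hk, hyk⟩ := hcov' y hy
  refine rel_of_cover (ι := {j // (A j).Nontrivial}) (A := fun j => A j) (j := ⟨j, hj⟩)
    (k := ⟨k, hk⟩) (r := fun j k => ∀ x ∈ T j, ∀ y ∈ T k, r x y) hs
    (hA.comp_injective Subtype.val_injective) (fun j => hAc j) (fun z hz => ?_)
    (fun {i j k} hij hjk x hx z hz => ?_) (fun z _ j k hzj hzk x hx y hy => ?_) hx hy hxj hyk
    x (hxT j hxj) y (hyT k hyk)
  · obtain ⟨j, hj, hzj⟩ := hcov' z hz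
    exact mem_iUnion.2 ⟨⟨j, hj⟩, hzj⟩
  · obtain ⟨y, hy⟩ := hTne j j.2
    exact trans (hij x hx y hy) (hjk y hy z hz)
  · rcases eq_or_ne j k with rfl | hjk
    · exact hT j x hx y hy
    · have hjk' : (j : ι) ≠ k := Subtype.coe_injective.ne hjk
      exact trans (hT j x hx z (hmeet j k hjk' j.2 k.2 ⟨hzj, hzk⟩))
        (hT k z (hmeet k j hjk'.symm k.2 j.2 ⟨hzk, hzj⟩) y hy)

end Covers

section Segments

variable {𝕜 E : Type*} [Field 𝕜] [LinearOrder 𝕜] [IsStrictOrderedRing 𝕜] [AddCommGroup E]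
  [Module 𝕜 E] {a b p q x y : E}

theorem eq_or_eq_of_left_mem_subsegment (hp : p ∈ segment 𝕜 a b) (hq : q ∈ segment 𝕜 a b)
    (ha : a ∈ segment 𝕜 p q) : a = p ∨ a = q := by
  rw [mem_segment_iff_wbtw] at hp hq ha
  refine or_iff_not_imp_left.2 fun hap => ?_
  have hqab : Wbtw 𝕜 q a b := ha.symm.trans_expand_left hp hap
  exact hq.swap_left_iff.1 hqab

theorem mem_or_mem_of_collinear (hcol : Collinear 𝕜 {p, q, y}) (hx : x ∈ segment 𝕜 p q) :
    y ∈ segment 𝕜 p q ∨ p ∈ segment 𝕜 x y ∨ q ∈ segment 𝕜 x y := by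
  simp only [mem_segment_iff_wbtw] at hx ⊢
  rcases hcol.wbtw_or_wbtw_or_wbtw with hpqy | hqyp | hypq
  · exact .inr (.inr (hpqy.trans_left_right hx))
  · exact .inl hqyp.symm
  · exact .inr (.inl (hypq.symm.trans_left_right hx.symm))

theorem collinear_segment (a b : E) : Collinear 𝕜 (segment 𝕜 a b) := by
  refine (collinear_iff_exists_forall_eq_smul_vadd _).2 ⟨a, b - a, fun z hz => ?_⟩
  rw [segment_eq_image'] at hz
  obtain ⟨θ, -, rfl⟩ := hz
  exact ⟨θ, add_comm _ _⟩

theorem eq_or_eq_of_segment_inter_subsingleton {L C : Set E} (hL : Collinear 𝕜 L)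
    (hpq : segment 𝕜 p q ⊆ L) (hCL : C ⊆ L) (hC : Convex 𝕜 C) (hC' : C.Nontrivial)
    (hsub : (segment 𝕜 p q ∩ C).Subsingleton) (hx : x ∈ segment 𝕜 p q) (hxC : x ∈ C) :
    x = p ∨ x = q := by
  obtain ⟨y, hyC, hyx⟩ := hC'.exists_ne x
  have hxy : segment 𝕜 x y ⊆ C := hC.segment_subset hxC hyC
  have hp := left_mem_segment 𝕜 p q
  have hq := right_mem_segment 𝕜 p q
  have hcol : Collinear 𝕜 {p, q, y} := hL.subset <|
    insert_subset (hpq hp) <| insert_subset (hpq hq) <| singleton_subset_iff.2 (hCL hyC)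
  rcases mem_or_mem_of_collinear hcol hx with hy | hpC | hqC
  · exact absurd (hsub ⟨hy, hyC⟩ ⟨hx, hxC⟩) hyx
  · exact .inl (hsub ⟨hx, hxC⟩ ⟨hp, hxy hpC⟩)
  · exact .inr (hsub ⟨hx, hxC⟩ ⟨hq, hxy hqC⟩)

theorem exists_endpoint_mem_segment_inter {c e : E} (hcol : Collinear 𝕜 {c, e, a})
    (hne : (segment 𝕜 a b ∩ segment 𝕜 c e).Nonempty) :
    ∃ y ∈ ({a, c, e} : Set E), y ∈ segment 𝕜 a b ∧ y ∈ segment 𝕜 c e := by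
  obtain ⟨z, hab, hce⟩ := hne
  have ha := left_mem_segment 𝕜 a b
  have hza : segment 𝕜 z a ⊆ segment 𝕜 a b := (convex_segment a b).segment_subset hab ha
  rcases mem_or_mem_of_collinear hcol hce with h | h | h
  · exact ⟨a, by simp, ha, h⟩
  · exact ⟨c, by simp, hza h, left_mem_segment 𝕜 c e⟩
  · exact ⟨e, by simp, hza h, right_mem_segment 𝕜 c e⟩

end Segments

section SegmentCovers

variable {E ι κ : Type*} [AddCommGroup E] [Module ℝ E] [TopologicalSpace E]
  [IsTopologicalAddGroup E] [ContinuousSMul ℝ E]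

theorem isClosed_segment [T2Space E] (a b : E) : IsClosed (segment ℝ a b) :=
  convexHull_pair (𝕜 := ℝ) a b ▸ (toFinite _).isClosed_convexHull ℝ

theorem joinedIn_of_segment_cover [T2Space E] [Finite ι] [Finite κ] {S : Set E} {a b : E}
    {p q : ι → E} {C : κ → Set E} (hab : a ≠ b) (hpq : ∀ i, segment ℝ (p i) (q i) ⊆ segment ℝ a b)
    (hCab : ∀ k, C k ⊆ segment ℝ a b) (hC : ∀ k, Convex ℝ (C k)) (hCc : ∀ k, IsClosed (C k))
    (hCS : ∀ k, C k ⊆ S) (hcov : segment ℝ a b ⊆ (⋃ i, segment ℝ (p i) (q i)) ∪ ⋃ k, C k)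
    (hpp : Pairwise fun i j => (segment ℝ (p i) (q i) ∩ segment ℝ (p j) (q j)).Subsingleton)
    (hpC : ∀ i k, (segment ℝ (p i) (q i) ∩ C k).Subsingleton)
    (hjoin : ∀ i, JoinedIn S (p i) (q i)) : JoinedIn S a b := by
  have ha := left_mem_segment ℝ a b
  have hb := right_mem_segment ℝ a b
  have hp i := hpq i (left_mem_segment ℝ _ _)
  have hq i := hpq i (right_mem_segment ℝ _ _)
  have hcol := collinear_segment (𝕜 := ℝ) a b
  refine rel_of_cover_of_contacts (ι := ι ⊕ κ) (s := segment ℝ a b) (r := JoinedIn S)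
    (A := Sum.elim (fun i => segment ℝ (p i) (q i)) C) (T := Sum.elim (fun i => {p i, q i}) C)
    (convex_segment a b).isPreconnected ⟨a, ha, b, hb, hab⟩ (locallyFinite_of_finite _)
    ?closed ?cover ?nonempty JoinedIn.trans ?joined ?meet ha hb ?left ?right
  case closed =>
    rintro (i | k)
    · exact isClosed_segment (p i) (q i)
    · exact hCc k
  case cover => rwa [iUnion_sum]
  case nonempty =>
    rintro (i | k) hk
    · exact insert_nonempty _ _
    · exact hk.nonempty
  case joined =>
    rintro (i | k) x hx y hy
    · have hi := hjoin i
      rcases hx with rfl | rfl <;> rcases hy with rfl | rfl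
      exacts [.refl hi.source_mem, hi, hi.symm, .refl hi.target_mem]
    · exact .of_segment_subset (((hC k).segment_subset hx hy).trans (hCS k))
  case meet =>
    rintro (i | k) (j | l) hne - hk x ⟨hxj, hxk⟩
    · exact eq_or_eq_of_segment_inter_subsingleton hcol (hpq i) (hpq j) (convex_segment _ _) hk
        (hpp (Sum.inl_injective.ne_iff.1 hne)) hxj hxk
    · exact eq_or_eq_of_segment_inter_subsingleton hcol (hpq i) (hCab l) (hC l) hk (hpC i l) hxj hxk
    · exact hxj
    · exact hxj
  case left =>
    rintro (i | k) hx
    · exact eq_or_eq_of_left_mem_subsegment (hp i) (hq i) hx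
    · exact hx
  case right =>
    rintro (i | k) hx
    · exact eq_or_eq_of_left_mem_subsegment (segment_symm ℝ a b ▸ hp i)
        (segment_symm ℝ a b ▸ hq i) hx
    · exact hx

end SegmentCovers

section Crossings

/-- The cross product `z₁ w₂ - z₂ w₁` of two plane vectors. It vanishes exactly if the vectors are
linearly dependent, and serves to express the intersection point of two lines. -/
def cross (z w : ℂ) : ℝ := z.re * w.im - z.im * w.re

theorem cross_smul_smul (r s : ℝ) (z w : ℂ) : cross (r • z) (s • w) = r * s * cross z w := by
  simp only [cross, Complex.smul_re, Complex.smul_im, smul_eq_mul]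
  ring

theorem cross_ne_zero_of_linearIndependent {z w : ℂ} (h : LinearIndependent ℝ ![z, w]) :
    cross z w ≠ 0 := by
  intro h0
  rw [LinearIndependent.pair_iff] at h
  unfold cross at h0
  have hre := h w.re (-z.re) (Complex.ext (by simp; ring) (by simp; linarith))
  have him := h w.im (-z.im) (Complex.ext (by simp; linarith) (by simp; ring))
  have hz : z = 0 := Complex.ext (neg_eq_zero.1 hre.2) (neg_eq_zero.1 him.2)
  simpa using h 1 0 (by simp [hz])

theorem tendsto_cross {T : Type*} {l : Filter T} {f g : T → ℂ} {z w : ℂ}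
    (hf : Tendsto f l (𝓝 z)) (hg : Tendsto g l (𝓝 w)) :
    Tendsto (fun t => cross (f t) (g t)) l (𝓝 (cross z w)) := by
  have : Continuous fun p : ℂ × ℂ => cross p.1 p.2 := by
    unfold cross; fun_prop
  exact (this.tendsto _).comp (hf.prodMk_nhds hg)

theorem add_smul_eq_add_smul_iff {x y u v : ℂ} (h : cross u v ≠ 0) {θ κ : ℝ} :
    x + θ • u = y + κ • v ↔
      θ = cross (y - x) v / cross u v ∧ κ = cross (y - x) u / cross u v := by
  rw [eq_div_iff h, eq_div_iff h, Complex.ext_iff]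
  simp only [cross, Complex.add_re, Complex.add_im, Complex.sub_re, Complex.sub_im,
    Complex.smul_re, Complex.smul_im, smul_eq_mul] at h ⊢
  refine ⟨fun ⟨hre, him⟩ => ⟨?_, ?_⟩, fun ⟨hθ, hκ⟩ => ⟨?_, ?_⟩⟩
  · linear_combination v.im * hre - v.re * him
  · linear_combination u.im * hre - u.re * him
  · exact mul_left_cancel₀ h (by linear_combination u.re * hθ - v.re * hκ)
  · exact mul_left_cancel₀ h (by linear_combination u.im * hθ - v.im * hκ)

theorem eventually_openSegment_inter_nonempty {T : Type*} {l : Filter T} {a b c e : T → ℂ}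
    {a₀ b₀ c₀ e₀ : ℂ} (ha : Tendsto a l (𝓝 a₀)) (hb : Tendsto b l (𝓝 b₀))
    (hc : Tendsto c l (𝓝 c₀)) (he : Tendsto e l (𝓝 e₀)) (hcross : cross (b₀ - a₀) (e₀ - c₀) ≠ 0)
    (hmeet : (openSegment ℝ a₀ b₀ ∩ openSegment ℝ c₀ e₀).Nonempty) :
    ∀ᶠ t in l, (openSegment ℝ (a t) (b t) ∩ openSegment ℝ (c t) (e t)).Nonempty := by
  simp only [openSegment_eq_image'] at hmeet ⊢
  obtain ⟨_, ⟨θ, hθ, rfl⟩, κ, hκ, hz⟩ := hmeet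
  obtain ⟨rfl, rfl⟩ := (add_smul_eq_add_smul_iff hcross).1 hz.symm
  have hdet := tendsto_cross (hb.sub ha) (he.sub hc)
  have hθt := (tendsto_cross (hc.sub ha) (he.sub hc)).div hdet hcross
  have hκt := (tendsto_cross (hc.sub ha) (hb.sub ha)).div hdet hcross
  filter_upwards [hθt.eventually_mem (Ioo_mem_nhds hθ.1 hθ.2),
    hκt.eventually_mem (Ioo_mem_nhds hκ.1 hκ.2), hdet.eventually_ne hcross] with t h1 h2 h3
  exact ⟨_, ⟨_, h1, rfl⟩, _, h2, ((add_smul_eq_add_smul_iff h3).2 ⟨rfl, rfl⟩).symm⟩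

end Crossings

theorem cross_ne_zero_of_norm_eq_one {d e : ℂ} (hd : ‖d‖ = 1) (he : ‖e‖ = 1) (hne : e ≠ d)
    (hopp : e ≠ -d) : cross d e ≠ 0 := by
  refine cross_ne_zero_of_linearIndependent <| not_not.1 fun hdep => ?_
  rcases sameRay_or_sameRay_neg_iff_not_linearIndependent.2 hdep with h | h
  · exact hne ((sameRay_iff_of_norm_eq (hd.trans he.symm)).1 h).symm
  · have hde := (sameRay_iff_of_norm_eq (by rw [norm_neg, hd, he])).1 h
    exact hopp (neg_eq_iff_eq_neg.1 hde.symm)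

theorem SimplePolygon.norm_dir {n : ℕ} (P : SimplePolygon n) (e : Fin n) : ‖P.dir e‖ = 1 := by
  have h : P.vertices (finRotate n e) - P.vertices e ≠ 0 := sub_ne_zero.2 (P.simple.1 e).symm
  rw [SimplePolygon.dir, norm_smul, norm_inv, norm_norm, inv_mul_cancel₀ (norm_ne_zero_iff.2 h)]

theorem sameCycle_induction {α : Type*} [Finite α] {f : Equiv.Perm α} {x : α} {p : α → Prop}
    (refl : p x) (step : ∀ y, f.SameCycle x y → p y → p (f y)) {y : α} (h : f.SameCycle x y) :
    p y := by
  obtain ⟨k, -, rfl⟩ := h.exists_pow_eq'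
  clear h
  induction k with
  | zero => exact refl
  | succ k ih =>
    rw [pow_succ', Equiv.Perm.mul_apply]
    exact step _ ⟨k, by simp⟩ ih

namespace KineticWavefront

variable {n : ℕ} {K K' : KineticWavefront n} {P : SimplePolygon n} {δ : Fin n → NNReal}

namespace Propagates

variable {a b : ℝ} {v w : Fin K.m} {z : ℂ}

theorem sub_eq_norm_smul_dir (h : K.Propagates P δ a b) (hab : a < b) (v : Fin K.m) {t : ℝ}
    (ht : t ∈ Icc a b) :
    K.pos (K.next v) t - K.pos v t =
      ‖K.pos (K.next v) t - K.pos v t‖ • P.dir (K.label v) := by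
  have hcont := (h.continuousOn (K.next v)).sub (h.continuousOn v)
  have hIco : EqOn (fun t => K.pos (K.next v) t - K.pos v t)
      (fun t => ‖K.pos (K.next v) t - K.pos v t‖ • P.dir (K.label v)) (Ico a b) := by
    intro t ht
    obtain ⟨r, hr, hsub⟩ := h.oriented v t ht
    simp only [hsub, norm_smul, P.norm_dir, mul_one, Real.norm_of_nonneg hr.le]
  exact hIco.of_subset_closure hcont (hcont.norm.smul continuousOn_const) Ico_subset_Icc_self
    (closure_Ico hab.ne).ge ht

theorem exists_pos_eq_of_mem_edge_of_mem_edge (h : K.Propagates P δ a b) (hab : a < b)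
    (hvw : v ≠ w) (hcyc : K.next.SameCycle v w) (hne : P.dir (K.label w) ≠ P.dir (K.label v))
    (hopp : P.dir (K.label w) ≠ -P.dir (K.label v)) (hzv : z ∈ K.edge v b)
    (hzw : z ∈ K.edge w b) : ∃ u, K.pos u b = z := by
  by_contra! hz
  have hb := right_mem_Icc.2 hab.le
  have hopen : ∀ u, z ∈ K.edge u b → z ∈ openSegment ℝ (K.pos u b) (K.pos (K.next u) b) :=
    fun u => mem_openSegment_of_ne_left_right (hz u) (hz (K.next u))
  have hlen : ∀ u, z ∈ K.edge u b → ‖K.pos (K.next u) b - K.pos u b‖ ≠ 0 := fun u hu h0 => by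
    have hzu := hopen u hu
    rw [sub_eq_zero.1 (norm_eq_zero.1 h0), openSegment_same] at hzu
    exact hz _ hzu.symm
  have hcross :
      cross (K.pos (K.next v) b - K.pos v b) (K.pos (K.next w) b - K.pos w b) ≠ 0 := by
    rw [h.sub_eq_norm_smul_dir hab v hb, h.sub_eq_norm_smul_dir hab w hb, cross_smul_smul]
    exact mul_ne_zero (mul_ne_zero (hlen v hzv) (hlen w hzw))
      (cross_ne_zero_of_norm_eq_one (P.norm_dir _) (P.norm_dir _) hne hopp)
  have htend : ∀ u, Tendsto (K.pos u) (𝓝[Ico a b] b) (𝓝 (K.pos u b)) := fun u =>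
    (h.continuousOn u b hb).mono Ico_subset_Icc_self
  have : (𝓝[Ico a b] b).NeBot := right_nhdsWithin_Ico_neBot hab
  obtain ⟨t, ht, y, hyv, hyw⟩ := (eventually_mem_nhdsWithin.and <|
    eventually_openSegment_inter_nonempty (htend v) (htend _) (htend w) (htend _) hcross
      ⟨z, hopen v hzv, hopen w hzw⟩).exists
  obtain ⟨hpos, hsimple⟩ := h.simple t ht
  rcases hsimple v w hcyc hvw y
      ⟨openSegment_subset_segment _ _ _ hyv, openSegment_subset_segment _ _ _ hyw⟩
    with ⟨-, rfl⟩ | ⟨-, rfl⟩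
  · exact hpos w (left_mem_openSegment_iff.1 hyw)
  · exact hpos v (left_mem_openSegment_iff.1 hyv)

theorem exists_dir_ne (h : K.Propagates P δ a b) (hab : a < b) (u : Fin K.m) :
    ∃ v, K.next.SameCycle u v ∧ P.dir (K.label (K.next v)) ≠ P.dir (K.label v) := by
  by_contra! hconst
  have hdir : ∀ v, K.next.SameCycle u v → P.dir (K.label v) = P.dir (K.label u) := fun v =>
    sameCycle_induction (p := fun v => P.dir (K.label v) = P.dir (K.label u)) rfl
      fun y hy ih => (hconst y hy).trans ih
  obtain ⟨v, hv, hmax⟩ := exists_max_image {v | K.next.SameCycle u v}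
    (fun v => inner ℝ (P.dir (K.label u)) (K.pos v a)) (toFinite _) ⟨u, .refl _ _⟩
  obtain ⟨r, hr, hsub⟩ := h.oriented v a (left_mem_Ico.2 hab)
  have hinc : inner ℝ (P.dir (K.label u)) (K.pos (K.next v) a) =
      inner ℝ (P.dir (K.label u)) (K.pos v a) + r := by
    rw [sub_eq_iff_eq_add'.1 hsub, inner_add_right, hdir v hv, inner_smul_right,
      real_inner_self_eq_norm_sq, P.norm_dir, one_pow, mul_one]
  have hle := hmax (K.next v) (Equiv.Perm.SameCycle.apply_right hv)
  linarith

theorem exists_eq_smul_dir_vadd (h : K.Propagates P δ a b) (hab : a < b) {t : ℝ}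
    (ht : t ∈ Icc a b) {y : ℂ} (hz : z ∈ K.edge v t) (hy : y ∈ K.edge v t) :
    ∃ r : ℝ, y = r • P.dir (K.label v) +ᵥ z := by
  rw [edge, edgeSeg, segment_eq_image', h.sub_eq_norm_smul_dir hab v ht] at hz hy
  obtain ⟨θ, -, rfl⟩ := hz
  obtain ⟨η, -, rfl⟩ := hy
  refine ⟨(η - θ) * ‖K.pos (K.next v) t - K.pos v t‖, ?_⟩
  rw [vadd_eq_add]
  module

theorem collinear_edge_union_edge (h : K.Propagates P δ a b) (hab : a < b) {t : ℝ}
    (ht : t ∈ Icc a b) (hopp : P.dir (K.label w) = -P.dir (K.label v)) (hzv : z ∈ K.edge v t)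
    (hzw : z ∈ K.edge w t) : Collinear ℝ (K.edge v t ∪ K.edge w t) := by
  refine (collinear_iff_exists_forall_eq_smul_vadd _).2 ⟨z, P.dir (K.label v), ?_⟩
  rintro y (hy | hy)
  · exact h.exists_eq_smul_dir_vadd hab ht hzv hy
  · obtain ⟨r, hr⟩ := h.exists_eq_smul_dir_vadd hab ht hzw hy
    exact ⟨-r, by rw [hr, hopp, neg_smul, smul_neg]⟩

theorem exists_pos_mem_common (h : K.Propagates P δ a b) (hab : a < b) {t : ℝ}
    (ht : t ∈ Icc a b) (hz : z ∈ K.common P v w t) : ∃ u, K.pos u t ∈ K.common P v w t := by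
  obtain ⟨hopp, hzv, hzw⟩ := hz
  have hcol : Collinear ℝ {K.pos w t, K.pos (K.next w) t, K.pos v t} :=
    (h.collinear_edge_union_edge hab ht hopp hzv hzw).subset <|
      insert_subset (.inr (left_mem_segment ℝ _ _)) <|
      insert_subset (.inr (right_mem_segment ℝ _ _)) <|
      singleton_subset_iff.2 (.inl (left_mem_segment ℝ _ _))
  obtain ⟨_, rfl | rfl | rfl, hv, hw⟩ := exists_endpoint_mem_segment_inter hcol ⟨z, hzv, hzw⟩
  exacts [⟨_, hopp, hv, hw⟩, ⟨_, hopp, hv, hw⟩, ⟨_, hopp, hv, hw⟩]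

end Propagates

theorem convex_common (K : KineticWavefront n) (P : SimplePolygon n) (v w : Fin K.m) (t : ℝ) :
    Convex ℝ (K.common P v w t) :=
  convex_iff_segment_subset.2 fun _ ⟨hopp, hxv, hxw⟩ _ ⟨_, hyv, hyw⟩ _ hz =>
    ⟨hopp, (convex_segment _ _).segment_subset hxv hyv hz,
      (convex_segment _ _).segment_subset hxw hyw hz⟩

theorem isClosed_common (K : KineticWavefront n) (P : SimplePolygon n) (v w : Fin K.m) (t : ℝ) :
    IsClosed (K.common P v w t) :=
  isClosed_const.inter ((isClosed_segment _ _).inter (isClosed_segment _ _))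

theorem joinedIn_of_mem_common {S : Set ℂ} {v w : Fin K.m} {t : ℝ} (hS : K.common P v w t ⊆ S)
    {y z : ℂ} (hy : y ∈ K.common P v w t) (hz : z ∈ K.common P v w t) : JoinedIn S y z :=
  .of_segment_subset (((K.convex_common P v w t).segment_subset hy hz).trans hS)

namespace Event

variable {T : ℝ} {S : Set ℂ}

theorem joinedIn_next (he : Event P K K' T) (hpos : ∀ v, K.pos v T ∈ S)
    (hcommon : ∀ v w, K.common P v w T ⊆ S)
    (hnext : ∀ u, JoinedIn S (K'.pos u T) (K'.pos (K'.next u) T)) (v : Fin K.m) :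
    JoinedIn S (K.pos v T) (K.pos (K.next v) T) := by
  obtain ⟨parent, -, hsub, hcov, hchildren, hpC, -, -⟩ := he
  rcases eq_or_ne (K.pos v T) (K.pos (K.next v) T) with hv | hv
  · exact hv ▸ .refl (hpos v)
  have hcov' : segment ℝ (K.pos v T) (K.pos (K.next v) T) ⊆
      (⋃ u : {u // parent u = v}, segment ℝ (K'.pos u T) (K'.pos (K'.next u) T)) ∪
        ⋃ w, K.common P v w T := fun z hz => by
    rcases hcov v hv z hz with ⟨u, hu, hzu⟩ | ⟨w, hzw⟩
    · exact .inl (mem_iUnion.2 ⟨⟨u, hu⟩, hzu⟩)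
    · exact .inr (mem_iUnion.2 ⟨w, hzw⟩)
  refine joinedIn_of_segment_cover hv ?_ (fun w z hz => hz.2.1) (K.convex_common P v · T)
    (K.isClosed_common P v · T) (hcommon v) hcov'
    (fun u u' hne => hchildren u u' (Subtype.coe_injective.ne hne) (u.2.trans u'.2.symm)) ?_
    (fun u => hnext u)
  · rintro ⟨u, rfl⟩
    exact hsub u
  · rintro ⟨u, rfl⟩
    exact hpC u

theorem exists_sameCycle_joinedIn {a b : ℝ} (he : Event P K K' T) (hK : K.Propagates P δ a T)
    (haT : a < T) (hK' : K'.Propagates P δ T b) (hTb : T < b) (hpos : ∀ v, K.pos v T ∈ S)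
    (hcommon : ∀ v w, K.common P v w T ⊆ S) (u : Fin K'.m) :
    ∃ u', K'.next.SameCycle u u' ∧ ∃ v, JoinedIn S (K.pos v T) (K'.pos u' T) := by
  obtain ⟨parent, hlabel, hsub, -, -, -, hcyc, hpar⟩ := he
  obtain ⟨x, hux, hturn⟩ := hK'.exists_dir_ne hTb u
  have hx : K'.next.SameCycle x (K'.next x) := Equiv.Perm.SameCycle.apply_right (.refl _ _)
  refine ⟨K'.next x, hux.trans hx, ?_⟩
  have hz : K'.pos (K'.next x) T ∈ K.edge (parent x) T := hsub x (right_mem_segment ℝ _ _)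
  have hz' : K'.pos (K'.next x) T ∈ K.edge (parent (K'.next x)) T :=
    hsub _ (left_mem_segment ℝ _ _)
  rw [hlabel, hlabel] at hturn
  by_cases hopp : P.dir (K.label (parent (K'.next x))) = -P.dir (K.label (parent x))
  · obtain ⟨v, hv⟩ := hK.exists_pos_mem_common haT (right_mem_Icc.2 haT.le) ⟨hopp, hz, hz'⟩
    exact ⟨v, joinedIn_of_mem_common (hcommon _ _) hv ⟨hopp, hz, hz'⟩⟩
  · obtain ⟨v, hv⟩ := hK.exists_pos_eq_of_mem_edge_of_mem_edge haT (hpar x).symm (hcyc _ _ hx)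
      hturn hopp hz hz'
    exact ⟨v, hv ▸ .refl (hpos v)⟩

end Event

end KineticWavefront

namespace WavefrontPropagation

variable {n : ℕ} {P : SimplePolygon n} {δ : Fin n → NNReal} (W : WavefrontPropagation P δ) {i : ℕ}

theorem time_mem_Icc (hi : i < W.N) : W.time i ∈ Icc (W.time i) (W.time (i + 1)) :=
  left_mem_Icc.2 (W.time_lt i hi).le

theorem time_succ_mem_Icc (hi : i < W.N) : W.time (i + 1) ∈ Icc (W.time i) (W.time (i + 1)) :=
  right_mem_Icc.2 (W.time_lt i hi).le

theorem lt_N_of_vertex (hi : i ≤ W.N) (v : Fin (W.wave i).m) : i < W.N := by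
  refine hi.lt_of_ne ?_
  rintro rfl
  exact (Fin.cast W.finish v).elim0

theorem pos_mem_skeleton (hi : i < W.N) (v : Fin (W.wave i).m) {s : ℝ}
    (hs : s ∈ Icc (W.time i) (W.time (i + 1))) : (W.wave i).pos v s ∈ W.skeleton :=
  mem_iUnion.2 ⟨s, .inl ⟨i, hi, v, s, hs, le_rfl, rfl⟩⟩

theorem common_subset_skeleton (hi : i < W.N) (v w : Fin (W.wave i).m) :
    (W.wave i).common P v w (W.time (i + 1)) ⊆ W.skeleton :=
  fun _ hz => mem_iUnion.2 ⟨W.time (i + 1), .inr ⟨i, hi, le_rfl, v, w, hz⟩⟩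

theorem joinedIn_trace (hi : i < W.N) (v : Fin (W.wave i).m) {s s' : ℝ}
    (hs : s ∈ Icc (W.time i) (W.time (i + 1))) (hs' : s' ∈ Icc (W.time i) (W.time (i + 1))) :
    JoinedIn W.skeleton ((W.wave i).pos v s) ((W.wave i).pos v s') := by
  have hpath : IsPathConnected ((W.wave i).pos v '' Icc (W.time i) (W.time (i + 1))) :=
    ((convex_Icc _ _).isPathConnected ⟨s, hs⟩).image' ((W.propagates i hi).continuousOn v)
  refine (hpath.joinedIn _ (mem_image_of_mem _ hs) _ (mem_image_of_mem _ hs')).mono ?_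
  exact image_subset_iff.2 fun r hr => W.pos_mem_skeleton hi v hr

theorem joinedIn_next (hi : i ≤ W.N) (v : Fin (W.wave i).m) :
    JoinedIn W.skeleton ((W.wave i).pos v (W.time i))
      ((W.wave i).pos ((W.wave i).next v) (W.time i)) := by
  induction hi using Nat.decreasingInduction with
  | self => exact absurd (W.lt_N_of_vertex le_rfl v) (lt_irrefl _)
  | of_succ i hi ih =>
    have hstart := W.time_mem_Icc hi
    have hend := W.time_succ_mem_Icc hi
    have hevent := (W.event i hi).joinedIn_next (fun v => W.pos_mem_skeleton hi v hend)
      (W.common_subset_skeleton hi) ih v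
    exact ((W.joinedIn_trace hi v hstart hend).trans hevent).trans
      (W.joinedIn_trace hi _ hend hstart)

theorem joinedIn_of_sameCycle (hi : i < W.N) {v w : Fin (W.wave i).m}
    (h : (W.wave i).next.SameCycle v w) :
    JoinedIn W.skeleton ((W.wave i).pos v (W.time i)) ((W.wave i).pos w (W.time i)) :=
  sameCycle_induction (p := fun w => JoinedIn W.skeleton _ ((W.wave i).pos w (W.time i)))
    (.refl (W.pos_mem_skeleton hi v (W.time_mem_Icc hi)))
    (fun x _ hx => hx.trans (W.joinedIn_next hi.le x)) h

theorem nonempty_vertex_zero : Nonempty (Fin (W.wave 0).m) :=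
  W.start.elim fun φ _ => ⟨φ ⟨0, by have := P.three_le; omega⟩⟩

theorem sameCycle_wave_zero (v w : Fin (W.wave 0).m) : (W.wave 0).next.SameCycle v w := by
  obtain ⟨φ, hφ⟩ := W.start
  obtain ⟨j, rfl⟩ := φ.surjective v
  obtain ⟨k, rfl⟩ := φ.surjective w
  have hn : 2 ≤ n := le_of_lt P.three_le
  have hmove : ∀ x, finRotate n x ≠ x := fun x =>
    Equiv.Perm.mem_support.1 (support_finRotate_of_le hn ▸ Finset.mem_univ x)
  refine sameCycle_induction (p := fun k => (W.wave 0).next.SameCycle (φ j) (φ k)) (.refl _ _)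
    (fun y _ hy => ?_) ((isCycle_finRotate_of_le hn).sameCycle (hmove j) (hmove k))
  exact (hφ y).1 ▸ Equiv.Perm.SameCycle.apply_right hy

theorem exists_joinedIn_succ (hi : i < W.N) (u : Fin (W.wave (i + 1)).m) :
    ∃ v, JoinedIn W.skeleton ((W.wave i).pos v (W.time i))
      ((W.wave (i + 1)).pos u (W.time (i + 1))) := by
  have hi' := W.lt_N_of_vertex hi u
  have hend := W.time_succ_mem_Icc hi
  obtain ⟨u', hu, v, hv⟩ := (W.event i hi).exists_sameCycle_joinedIn (W.propagates i hi)
    (W.time_lt i hi) (W.propagates (i + 1) hi') (W.time_lt (i + 1) hi')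
    (fun v => W.pos_mem_skeleton hi v hend) (W.common_subset_skeleton hi) u
  exact ⟨v, ((W.joinedIn_trace hi v (W.time_mem_Icc hi) hend).trans hv).trans
    (W.joinedIn_of_sameCycle hi' hu.symm)⟩

theorem joinedIn_pos_zero (w : Fin (W.wave 0).m) (hi : i < W.N) (v : Fin (W.wave i).m) :
    JoinedIn W.skeleton ((W.wave 0).pos w (W.time 0)) ((W.wave i).pos v (W.time i)) := by
  induction i with
  | zero => exact W.joinedIn_of_sameCycle hi (W.sameCycle_wave_zero w v)
  | succ i ih =>
    obtain ⟨u, hu⟩ := W.exists_joinedIn_succ (i.lt_succ_self.trans hi) v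
    exact (ih (i.lt_succ_self.trans hi) u).trans hu

theorem exists_joinedIn_of_mem_skeleton {z : ℂ} (hz : z ∈ W.skeleton) :
    ∃ i < W.N, ∃ v, JoinedIn W.skeleton ((W.wave i).pos v (W.time i)) z := by
  obtain ⟨t, ⟨i, hi, v, s, hs, -, rfl⟩ | ⟨i, hi, -, v, w, hz⟩⟩ := mem_iUnion.1 hz
  · exact ⟨i, hi, v, W.joinedIn_trace hi v (W.time_mem_Icc hi) hs⟩
  · have hend := W.time_succ_mem_Icc hi
    obtain ⟨u, hu⟩ := (W.propagates i hi).exists_pos_mem_common (W.time_lt i hi) hend hz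
    exact ⟨i, hi, u, (W.joinedIn_trace hi u (W.time_mem_Icc hi) hend).trans
      (KineticWavefront.joinedIn_of_mem_common (W.common_subset_skeleton hi v w) hu hz)⟩

end WavefrontPropagation

end StraightSkeleton

theorem mainTheorem4_general {n : ℕ} (P : StraightSkeleton.SimplePolygon n) (δ : Fin n → NNReal)
    (W : StraightSkeleton.WavefrontPropagation P δ) : IsPathConnected W.skeleton := by
  obtain ⟨w⟩ := W.nonempty_vertex_zero
  have h0 := W.lt_N_of_vertex (Nat.zero_le _) w
  refine ⟨(W.wave 0).pos w (W.time 0), W.pos_mem_skeleton h0 w (W.time_mem_Icc h0),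
    fun {_} hz => ?_⟩
  obtain ⟨i, hi, v, hv⟩ := W.exists_joinedIn_of_mem_skeleton hz
  exact (W.joinedIn_pos_zero w hi v).trans hv

theorem mainTheorem4 {n : ℕ} (P : StraightSkeleton.SimplePolygon n) (δ : Fin n → NNReal)
    (W : StraightSkeleton.WavefrontPropagation P δ) (t : ℝ) (ht : 0 ≤ t)
    (p q : ℂ) (hp : p ∈ W.skeletonUntil t) (hq : q ∈ W.skeletonUntil t)
    (hpq : JoinedIn (W.skeletonUntil t ∪ W.wavefront t) p q) :
    JoinedIn W.skeleton p q :=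
  (mainTheorem4_general P δ W).joinedIn p (Set.mem_iUnion.2 ⟨t, hp⟩) q
    (Set.mem_iUnion.2 ⟨t, hq⟩)
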